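/- Let $\Gamma$ be a cancellation monoid (not necessarily commutative) with neutral element $\varepsilon$, and let $R=\bigoplus_{\alpha\in\Gamma}R_\alpha$ be a $\Gamma$-graded ring, that is, an associative (not necessarily commutative) ring with $1$ that is the direct sum of additive subgroups $R_\alpha$ with $R_\alpha R_\beta\subseteq R_{\alpha\beta}$ for all $\alpha,\beta\in\Gamma$. A $\Gamma$-graded left (resp. right) $R$-module is a left (resp. right) $R$-module $M=\bigoplus_{\alpha\in\Gamma}M_\alpha$ with additive subgroups $M_\alpha$ such that $R_\alpha M_\beta\subseteq M_{\alpha\beta}$ (resp. $M_\beta R_\alpha\subseteq M_{\beta\alpha}$) for all $\alpha,\beta\in\Gamma$. A submodule $N$ of $M$ is a graded submodule if it is generated by homogeneous elements; it is then graded by $N_\alpha=N\cap M_\alpha$. The graded left submodules of $R$ are the homogeneous left ideals. A homomorphism $f:M\to N$ of $\Gamma$-graded modules is homogeneous if $f(M_\alpha)\subseteq N_\alpha$ for all $\alpha$. For a $\Gamma$-graded right $R$-module $M$ and a $\Gamma$-graded left $R$-module $F$, the group $M\otimes_RF$ is graded by letting $(M\otimes_RF)_\gamma$ be generated by the $m\otimes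 x$ with $m\in M_\alpha$, $x\in F_\beta$, $\alpha\beta=\gamma$. A $\Gamma$-graded left $R$-module $F$ is gr-flat if $f\otimes_R1_F:M\otimes_RF\to N\otimes_RF$ is a homogeneous monomorphism for every homogeneous monomorphism $f:M\to N$ of $\Gamma$-graded right $R$-modules $M,N$. Then every homogeneous left ideal of $R$ is gr-flat if and only if every graded submodule of every gr-flat $\Gamma$-graded left $R$-module is gr-flat. -/

import Mathlib

open scoped TensorProduct
open MulOpposite

universe u v w

/-! Modules over a ring `R` that need not be commutative: left modules are `Module R F`, right
modules are `Module Rᵐᵒᵖ M`, with `m · r` written as `op r • m`. The degrees form a cancellative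
monoid `Γ` that need not be commutative; its operation is written additively. -/

namespace GrFlat

section Tensor

variable (R : Type*) [Ring R] (M N : Type*) [AddCommGroup M] [Module Rᵐᵒᵖ M]
  [AddCommGroup N] [Module Rᵐᵒᵖ N] (F : Type*) [AddCommGroup F] [Module R F]

/-- The relations `(m · r) ⊗ x = m ⊗ (r · x)` that turn `M ⊗_ℤ F` into `M ⊗_R F`. -/
def balancing : AddSubgroup (M ⊗[ℤ] F) :=
  AddSubgroup.closure {t | ∃ (m : M) (r : R) (x : F), t = (op r • m) ⊗ₜ[ℤ] x - m ⊗ₜ[ℤ] (r • x)}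

/-- The tensor product `M ⊗_R F` (an abelian group) of a right and a left `R`-module. -/
abbrev Tensor : Type _ := (M ⊗[ℤ] F) ⧸ balancing R M F

variable {M F} in
/-- The pure tensor `m ⊗ x` in `M ⊗_R F`. -/
def tmul (m : M) (x : F) : Tensor R M F := QuotientAddGroup.mk' (balancing R M F) (m ⊗ₜ[ℤ] x)

variable {M N} in
theorem balancing_le_comap (f : M →ₗ[Rᵐᵒᵖ] N) :
    balancing R M F ≤ (balancing R N F).comap
      (LinearMap.rTensor F f.toAddMonoidHom.toIntLinearMap).toAddMonoidHom := by
  refine (AddSubgroup.closure_le _).2 ?_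
  rintro _ ⟨m, r, x, rfl⟩
  exact AddSubgroup.subset_closure ⟨f m, r, x, by simp⟩

variable {R M N} in
/-- The homomorphism `f ⊗ 1 : M ⊗_R F → N ⊗_R F`. -/
def tensorMap (f : M →ₗ[Rᵐᵒᵖ] N) : Tensor R M F →+ Tensor R N F :=
  QuotientAddGroup.map (balancing R M F) (balancing R N F)
    (LinearMap.rTensor F f.toAddMonoidHom.toIntLinearMap).toAddMonoidHom
    (balancing_le_comap R F f)

end Tensor

section Graded

variable {Γ : Type w} [AddMonoid Γ] {R : Type u} [Ring R]

/-- The compatibility `M_β R_α ⊆ M_{βα}` of a grading of a right module with that of the ring. -/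
class GradedRightSMul (𝒜 : Γ → AddSubgroup R) {M : Type*} [AddCommGroup M] [Module Rᵐᵒᵖ M]
    (ℳ : Γ → AddSubgroup M) : Prop where
  smul_mem : ∀ {α β : Γ} {r : R} {m : M}, r ∈ 𝒜 α → m ∈ ℳ β → op r • m ∈ ℳ (β + α)

/-- The degree `γ` part of `M ⊗_R F`: it is generated by the `m ⊗ x` with `m` and `x`
homogeneous and `deg m + deg x = γ`. -/
def tensorGrading (R : Type*) [Ring R] {M F : Type*} [AddCommGroup M] [Module Rᵐᵒᵖ M]
    [AddCommGroup F] [Module R F] (ℳ : Γ → AddSubgroup M) (ℱ : Γ → AddSubgroup F) (γ : Γ) :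
    AddSubgroup (Tensor R M F) :=
  AddSubgroup.closure
    {t | ∃ α β : Γ, α + β = γ ∧ ∃ m ∈ ℳ α, ∃ x ∈ ℱ β, t = tmul R m x}

/-- A left module `F` with grading `ℱ` is gr-flat if, for every injective homogeneous
homomorphism `f : M → N` (of degree `0`) of graded right modules, `f ⊗ 1 : M ⊗_R F → N ⊗_R F` is
injective and homogeneous. -/
def IsGrFlat [DecidableEq Γ] (𝒜 : Γ → AddSubgroup R) {F : Type v} [AddCommGroup F] [Module R F]
    (ℱ : Γ → AddSubgroup F) : Prop :=
  ∀ (M N : Type (max u v)) [AddCommGroup M] [Module Rᵐᵒᵖ M] [AddCommGroup N] [Module Rᵐᵒᵖ N]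
    (ℳ : Γ → AddSubgroup M) [DirectSum.Decomposition ℳ] [GradedRightSMul 𝒜 ℳ]
    (𝒩 : Γ → AddSubgroup N) [DirectSum.Decomposition 𝒩] [GradedRightSMul 𝒜 𝒩]
    (f : M →ₗ[Rᵐᵒᵖ] N), (∀ γ, ∀ m ∈ ℳ γ, f m ∈ 𝒩 γ) → Function.Injective f →
      Function.Injective (tensorMap F f) ∧
        ∀ γ, ∀ t ∈ tensorGrading R ℳ ℱ γ, tensorMap F f t ∈ tensorGrading R 𝒩 ℱ γ

/-- The grading `N_γ = N ∩ F_γ` of a (homogeneous) submodule `N` of a graded module `F`. -/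
def inducedGrading {F : Type*} [AddCommGroup F] [Module R F] (ℱ : Γ → AddSubgroup F)
    (N : Submodule R F) (γ : Γ) : AddSubgroup N :=
  (ℱ γ).comap N.subtype.toAddMonoidHom

end Graded

end GrFlat

/-! Characters with values in ℚ/ℤ turn tensor statements into extension statements. A character of
`M ⊗_R F` is a balanced pairing of `M` with `F`, so `f ⊗ 1` is injective iff every such pairing
extends along `f` (`tensorMap_injective_iff`). By a graded Baer criterion
(`exists_extension_of_isHomogeneous`) it suffices to extend from homogeneous right ideals `K` to
`R`. Hence gr-flatness is equivalent to `RightIdealFlat`, which mentions no test modules and so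
transfers between universes. A pairing of `K` with a left ideal `I` can be read from either side. If
every homogeneous `I` is flat, then maps `I → K^*` extend to `R`; by Baer on the left, maps into
`K^*` extend from graded submodules `G ⊆ F` to `F`. A pairing of `K` with `G` thus extends to `F`,
where flatness of `F` makes it a character of the product `k • x`. The converse holds because `R`
itself is gr-flat. -/

namespace GrFlat

/-! ### Homogeneous components, induced gradings, and extension from homogeneous submodules -/

section Homogeneous

open DirectSum

variable {Γ : Type*} [DecidableEq Γ] {C N : Type*} [AddCommGroup C] [AddCommGroup N]
  (𝒞 : Γ → AddSubgroup C) [Decomposition 𝒞] (𝒩 : Γ → AddSubgroup N) [Decomposition 𝒩]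

/-- A homomorphism that moves degrees by an injective map commutes with taking components. -/
theorem decompose_map_apply {s : Γ → Γ} (hs : s.Injective) (g : C →+ N)
    (hg : ∀ α, ∀ c ∈ 𝒞 α, g c ∈ 𝒩 (s α)) (α : Γ) (c : C) :
    (decompose 𝒩 (g c) (s α) : N) = g (decompose 𝒞 c α) := by
  induction c using Decomposition.inductionOn 𝒞 with
  | zero => simp
  | @homogeneous β c =>
    by_cases h : β = α
    · subst h
      rw [decompose_of_mem_same 𝒩 (hg _ _ c.2), decompose_of_mem_same 𝒞 c.2]
    · rw [decompose_of_mem_ne 𝒩 (hg _ _ c.2) (hs.ne h), decompose_of_mem_ne 𝒞 c.2 h, map_zero]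
  | add c d hc hd => simp [hc, hd]

/-- Here `s` may merge degrees: each homogeneous summand of `c` contributes either its image or zero
to the component. -/
theorem decompose_map_mem_range {s : Γ → Γ} (g : C →+ N)
    (hg : ∀ α, ∀ c ∈ 𝒞 α, g c ∈ 𝒩 (s α)) (γ : Γ) (c : C) :
    (decompose 𝒩 (g c) γ : N) ∈ g.range := by
  induction c using Decomposition.inductionOn 𝒞 with
  | zero => simp
  | @homogeneous β c =>
    by_cases h : s β = γ
    · subst h
      rw [decompose_of_mem_same 𝒩 (hg _ _ c.2)]
      exact ⟨c, rfl⟩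
    · rw [decompose_of_mem_ne 𝒩 (hg _ _ c.2) h]
      exact zero_mem _
  | add c d hc hd =>
    rw [map_add, decompose_add, DirectSum.add_apply, AddSubgroup.coe_add]
    exact add_mem hc hd

/-- The grading induced on the source of an injective homomorphism with homogeneous image. -/
@[reducible]
noncomputable def decompositionComap {X : Type*} [AddCommGroup X] (e : X →+ N)
    (he : Function.Injective e) (h : ∀ x γ, (decompose 𝒩 (e x) γ : N) ∈ e.range) :
    Decomposition fun γ ↦ (𝒩 γ).comap e := by
  classical
  refine IsInternal.chooseDecomposition _ ⟨?_, ?_⟩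
  · let j : ∀ γ, (𝒩 γ).comap e →+ 𝒩 γ := fun γ ↦
      (e.comp ((𝒩 γ).comap e).subtype).codRestrict (𝒩 γ) fun x ↦ x.2
    have hj : Function.Injective (DirectSum.map j) := (DirectSum.map_injective j).2
      fun γ x y hxy ↦ Subtype.ext (he (congrArg Subtype.val hxy))
    have hcomp : (DirectSum.coeAddMonoidHom 𝒩).comp (DirectSum.map j) =
        e.comp (DirectSum.coeAddMonoidHom fun γ ↦ (𝒩 γ).comap e) := by
      ext γ x
      simp [j]
      rfl
    have := (Decomposition.isInternal 𝒩).1.comp hj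
    rw [← AddMonoidHom.coe_comp, hcomp, AddMonoidHom.coe_comp] at this
    exact this.of_comp
  · intro x
    choose c hc using h x
    refine ⟨∑ γ ∈ (decompose 𝒩 (e x)).support, DirectSum.of (fun γ ↦ (𝒩 γ).comap e) γ
      ⟨c γ, by rw [AddSubgroup.mem_comap, hc]; exact (decompose 𝒩 (e x) γ).2⟩, he ?_⟩
    simp only [map_sum, DirectSum.coeAddMonoidHom_of, hc]
    exact DirectSum.sum_support_decompose 𝒩 (e x)

end Homogeneous

/-- A graded form of Baer's criterion. -/
theorem exists_extension_of_isHomogeneous {S C N E Γ : Type*} [Ring S] [AddCommGroup C]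
    [Module S C] [AddCommGroup N] [Module S N] [AddCommGroup E] [Module S E] [DecidableEq Γ]
    (𝒞 : Γ → AddSubgroup C) [DirectSum.Decomposition 𝒞]
    (𝒩 : Γ → AddSubgroup N) [DirectSum.Decomposition 𝒩]
    (hE : ∀ K : Submodule S C, K.IsHomogeneous 𝒞 → ∀ φ : K →ₗ[S] E,
      ∃ ψ : C →ₗ[S] E, ∀ k : K, ψ k = φ k)
    (hN : ∀ γ, ∀ x ∈ 𝒩 γ, ∃ (s : Γ → Γ) (g : C →ₗ[S] N), s.Injective ∧
      x ∈ LinearMap.range g ∧ ∀ α, ∀ c ∈ 𝒞 α, g c ∈ 𝒩 (s α))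
    (L : Submodule S N) (hL : L.IsHomogeneous 𝒩) (φ : L →ₗ[S] E) :
    ∃ ψ : N →ₗ[S] E, ∀ l : L, ψ l = φ l := by
  -- Zorn's lemma is applied only to partial maps with homogeneous domain, so that testing
  -- homogeneous `x` is enough.
  obtain ⟨p, hp, hph, hmax⟩ : ∃ p : N →ₗ.[S] E, (⟨L, φ⟩ : N →ₗ.[S] E) ≤ p ∧
      Maximal (fun p : N →ₗ.[S] E ↦ p.domain.IsHomogeneous 𝒩) p := by
    refine zorn_le_nonempty₀ {p : N →ₗ.[S] E | p.domain.IsHomogeneous 𝒩}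
      (fun c hc hchain q hq ↦ ?_) _ hL
    have hdir := hchain.directedOn
    have : (LinearPMap.sSup c hdir).domain.IsHomogeneous 𝒩 := by
      intro γ x hx
      rw [LinearPMap.mem_domain_sSup_iff ⟨q, hq⟩] at hx ⊢
      obtain ⟨r, hr, hxr⟩ := hx
      exact ⟨r, hr, hc hr γ hxr⟩
    exact ⟨LinearPMap.sSup c hdir, this, fun r hr ↦ LinearPMap.le_sSup hdir hr⟩
  suffices htop : ∀ x, x ∈ p.domain from
    ⟨p.toFun ∘ₗ LinearMap.codRestrict p.domain LinearMap.id htop,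
      fun l ↦ (hp.2 (x := l) (y := ⟨l, htop l⟩) rfl).symm⟩
  intro x
  induction x using DirectSum.Decomposition.inductionOn 𝒩 with
  | zero => exact zero_mem _
  | add x y hx hy => exact add_mem hx hy
  | @homogeneous γ x =>
  obtain ⟨s, g, hs, hx, hg⟩ := hN γ x x.2
  have hK : (p.domain.comap g).IsHomogeneous 𝒞 := fun α c hc ↦ by
    have := hph (s α) hc
    rwa [← LinearMap.toAddMonoidHom_coe, decompose_map_apply 𝒞 𝒩 hs g.toAddMonoidHom hg] at this
  obtain ⟨ψ, hψ⟩ := hE _ hK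
    (p.toFun ∘ₗ (g.restrict fun _ h ↦ h : p.domain.comap g →ₗ[S] p.domain))
  have hψ' : ∀ (c : C) (hc : g c ∈ p.domain), ψ c = p ⟨g c, hc⟩ := fun c hc ↦ hψ ⟨c, hc⟩
  -- `ψ` agrees with `p ∘ g` where the latter is defined, in particular on `ker g`; so it descends
  -- to the range of `g`, which contains `x`.
  have hker : LinearMap.ker g ≤ LinearMap.ker ψ := fun c hc ↦ by
    have hc' : g c = 0 := hc
    rw [LinearMap.mem_ker, hψ' c (by rw [hc']; exact zero_mem _), ← p.map_zero]
    congr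
  let q : N →ₗ.[S] E :=
    ⟨LinearMap.range g, (LinearMap.ker g).liftQ ψ hker ∘ₗ g.quotKerEquivRange.symm.toLinearMap⟩
  have hq : ∀ (c : C) (y : q.domain), (y : N) = g c → q y = ψ c := by
    rintro c ⟨y, hy⟩ rfl
    change (LinearMap.ker g).liftQ ψ hker (g.quotKerEquivRange.symm ⟨g c, hy⟩) = ψ c
    rw [LinearMap.quotKerEquivRange_symm_apply_image]
    rfl
  have hpq : ∀ (a : p.domain) (b : q.domain), (a : N) = b → p a = q b := by
    rintro ⟨a, ha⟩ ⟨b, c, rfl⟩ rfl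
    rw [hq c _ rfl, hψ' c ha]
  have hsup : (p.sup q hpq).domain.IsHomogeneous 𝒩 := by
    intro δ y hy
    rw [LinearPMap.domain_sup] at hy ⊢
    obtain ⟨a, ha, b, ⟨c, rfl⟩, rfl⟩ := Submodule.mem_sup.1 hy
    rw [DirectSum.decompose_add, DirectSum.add_apply, AddSubgroup.coe_add]
    refine add_mem (Submodule.mem_sup_left (hph δ ha)) (Submodule.mem_sup_right ?_)
    exact decompose_map_mem_range 𝒞 𝒩 g.toAddMonoidHom hg δ c
  exact (hmax hsup (p.left_le_sup q hpq)).1 ((p.right_le_sup q hpq).1 hx)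

/-! ### Character modules and balanced pairings -/

section Character

/-- The characters of a left module form a right module, by `(φ · r) x = φ (r · x)`. -/
instance characterRightModule {R F : Type*} [Ring R] [AddCommGroup F] [Module R F] :
    Module Rᵐᵒᵖ (CharacterModule F) where
  smul r φ := φ.comp (DistribSMul.toAddMonoidHom F (unop r))
  one_smul φ := by ext x; exact congrArg φ (one_smul R x)
  mul_smul r s φ := by ext x; exact congrArg φ (mul_smul (unop s) (unop r) x)
  smul_zero r := rfl
  smul_add r φ ψ := rfl
  add_smul r s φ := by
    ext x
    exact (congrArg φ (add_smul (unop r) (unop s) x)).trans (map_add φ _ _)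
  zero_smul φ := by ext x; exact (congrArg φ (zero_smul R x)).trans (map_zero φ)

/-- The characters of a right module form a left module, by `(r · φ) m = φ (m · r)`. -/
instance characterLeftModule {R M : Type*} [Ring R] [AddCommGroup M] [Module Rᵐᵒᵖ M] :
    Module R (CharacterModule M) where
  smul r φ := φ.comp (DistribSMul.toAddMonoidHom M (op r))
  one_smul φ := by ext x; exact congrArg φ (one_smul Rᵐᵒᵖ x)
  mul_smul r s φ := by ext x; exact congrArg φ (mul_smul (op s) (op r) x)
  smul_zero r := rfl
  smul_add r φ ψ := rfl
  add_smul r s φ := by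
    ext x
    exact (congrArg φ (add_smul (op r) (op s) x)).trans (map_add φ _ _)
  zero_smul φ := by ext x; exact (congrArg φ (zero_smul Rᵐᵒᵖ x)).trans (map_zero φ)

variable {R M N F : Type*} [Ring R] [AddCommGroup M] [Module Rᵐᵒᵖ M] [AddCommGroup N]
  [Module Rᵐᵒᵖ N] [AddCommGroup F] [Module R F]

theorem op_smul_character_apply (r : R) (φ : CharacterModule F) (x : F) :
    (op r • φ) x = φ (r • x) := rfl

theorem smul_character_apply (r : R) (φ : CharacterModule M) (m : M) :
    (r • φ) m = φ (op r • m) := rfl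

theorem exists_character_extension {A B : Type*} [AddCommGroup A] [AddCommGroup B] (f : A →+ B)
    (hf : Function.Injective f) (φ : CharacterModule A) :
    ∃ ψ : CharacterModule B, ∀ a, ψ (f a) = φ a := by
  obtain ⟨ψ, rfl⟩ := CharacterModule.dual_surjective_of_injective f.toIntLinearMap hf φ
  exact ⟨ψ, fun _ ↦ rfl⟩

/-- The homomorphism `F → M^*` of a balanced biadditive map given as `M → F^*`. -/
def flipRight (b : M →ₗ[Rᵐᵒᵖ] CharacterModule F) : F →ₗ[R] CharacterModule M where
  toFun x := AddMonoidHom.mk' (fun m ↦ b m x) fun m n ↦ by rw [map_add]; rfl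
  map_add' x y := by ext m; exact map_add (b m) x y
  map_smul' r x := by
    ext m
    change b m (r • x) = b (op r • m) x
    rw [map_smul b, op_smul_character_apply]

/-- The homomorphism `M → F^*` of a balanced biadditive map given as `F → M^*`. -/
def flipLeft (b : F →ₗ[R] CharacterModule M) : M →ₗ[Rᵐᵒᵖ] CharacterModule F where
  toFun m := AddMonoidHom.mk' (fun x ↦ b x m) fun x y ↦ by rw [map_add]; rfl
  map_add' m n := by ext x; exact map_add (b x) m n
  map_smul' r m := by
    ext x
    change b x (r • m) = b (unop r • x) m
    rw [map_smul b, smul_character_apply, op_unop]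

theorem flipRight_apply (b : M →ₗ[Rᵐᵒᵖ] CharacterModule F) (m : M) (x : F) :
    flipRight b x m = b m x := rfl

theorem flipLeft_apply (b : F →ₗ[R] CharacterModule M) (m : M) (x : F) :
    flipLeft b m x = b x m := rfl

theorem tmul_add_left (m n : M) (x : F) : tmul R (m + n) x = tmul R m x + tmul R n x := by
  simp only [tmul, TensorProduct.add_tmul, map_add]

theorem tmul_add_right (m : M) (x y : F) : tmul R m (x + y) = tmul R m x + tmul R m y := by
  simp only [tmul, TensorProduct.tmul_add, map_add]

theorem tmul_op_smul (m : M) (r : R) (x : F) : tmul R (op r • m) x = tmul R m (r • x) := by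
  rw [tmul, tmul, ← sub_eq_zero, ← map_sub]
  exact (QuotientAddGroup.eq_zero_iff _).2 (AddSubgroup.subset_closure ⟨m, r, x, rfl⟩)

@[elab_as_elim]
theorem tensor_induction {p : Tensor R M F → Prop} (t : Tensor R M F) (zero : p 0)
    (tmul : ∀ m x, p (tmul R m x)) (add : ∀ s t, p s → p t → p (s + t)) : p t := by
  obtain ⟨t, rfl⟩ := QuotientAddGroup.mk'_surjective _ t
  induction t with
  | zero => exact zero
  | tmul m x => exact tmul m x
  | add s t hs ht => rw [map_add]; exact add _ _ hs ht

theorem tensorMap_mem_tensorGrading {Γ : Type*} [AddMonoid Γ] {ℳ : Γ → AddSubgroup M}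
    {𝒩 : Γ → AddSubgroup N} (ℱ : Γ → AddSubgroup F) (f : M →ₗ[Rᵐᵒᵖ] N)
    (hf : ∀ γ, ∀ m ∈ ℳ γ, f m ∈ 𝒩 γ) (γ : Γ) {t : Tensor R M F}
    (ht : t ∈ tensorGrading R ℳ ℱ γ) : tensorMap F f t ∈ tensorGrading R 𝒩 ℱ γ := by
  refine (AddSubgroup.closure_le ((tensorGrading R 𝒩 ℱ γ).comap (tensorMap F f))).2 ?_ ht
  rintro _ ⟨α, β, h, m, hm, x, hx, rfl⟩
  exact AddSubgroup.subset_closure ⟨α, β, h, f m, hf α m hm, x, hx, rfl⟩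

/-- The balanced map of a character of `M ⊗_R F`. -/
def curryCharacter (c : CharacterModule (Tensor R M F)) : M →ₗ[Rᵐᵒᵖ] CharacterModule F where
  toFun m := AddMonoidHom.mk' (fun x ↦ c (tmul R m x)) fun x y ↦ by
    rw [tmul_add_right, map_add]
  map_add' m n := by ext x; exact (congrArg c (tmul_add_left m n x)).trans (map_add c _ _)
  map_smul' r m := by ext x; exact congrArg c (tmul_op_smul m (unop r) x)

theorem exists_curryCharacter_eq (b : M →ₗ[Rᵐᵒᵖ] CharacterModule F) :
    ∃ c : CharacterModule (Tensor R M F), curryCharacter c = b := by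
  let l : M ⊗[ℤ] F →+ AddCircle (1 : ℚ) :=
    TensorProduct.liftAddHom (b.toAddMonoidHom : M →+ F →+ AddCircle (1 : ℚ)) fun n m x ↦
      (DFunLike.congr_fun (map_zsmul b n m) x).trans (map_zsmul (b m) n x).symm
  have hl : ∀ m x, l (m ⊗ₜ x) = b m x := fun m x ↦ rfl
  refine ⟨QuotientAddGroup.lift (balancing R M F) l ((AddSubgroup.closure_le _).2 ?_), ?_⟩
  · rintro _ ⟨m, r, x, rfl⟩
    change l _ = 0
    rw [map_sub, hl, hl, map_smul b, op_smul_character_apply, sub_self]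
  · ext m x
    exact hl m x

/-- Since ℚ/ℤ is an injective cogenerator, a homomorphism of abelian groups is injective iff every
character of its source extends along it. -/
theorem tensorMap_injective_iff (f : M →ₗ[Rᵐᵒᵖ] N) :
    Function.Injective (tensorMap F f) ↔
      ∀ b : M →ₗ[Rᵐᵒᵖ] CharacterModule F, ∃ b' : N →ₗ[Rᵐᵒᵖ] CharacterModule F,
        ∀ m, b' (f m) = b m := by
  constructor
  · intro h b
    obtain ⟨c, rfl⟩ := exists_curryCharacter_eq b
    obtain ⟨c', hc'⟩ := exists_character_extension _ h c
    refine ⟨curryCharacter c', fun m ↦ ?_⟩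
    ext x
    exact hc' (tmul R m x)
  · intro h
    refine (injective_iff_map_eq_zero _).2 fun t ht ↦
      CharacterModule.eq_zero_of_character_apply fun c ↦ ?_
    obtain ⟨b', hb'⟩ := h (curryCharacter c)
    obtain ⟨c', rfl⟩ := exists_curryCharacter_eq b'
    have : ∀ s, c' (tensorMap F f s) = c s := fun s ↦ by
      induction s using tensor_induction with
      | zero => simp
      | tmul m x => exact DFunLike.congr_fun (hb' m) x
      | add s t hs ht => rw [map_add, map_add, map_add, hs, ht]
    rw [← this, ht, map_zero]

end Character

/-- The compatibility of the grading of a right module passes to gradings induced along a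
homomorphism. -/
theorem gradedRightSMul_comap {Γ R M N : Type*} [AddMonoid Γ] [Ring R] [AddCommGroup M]
    [Module Rᵐᵒᵖ M] [AddCommGroup N] [Module Rᵐᵒᵖ N] (𝒜 : Γ → AddSubgroup R)
    (𝒩 : Γ → AddSubgroup N) [GradedRightSMul 𝒜 𝒩] (e : M →ₗ[Rᵐᵒᵖ] N) :
    GradedRightSMul 𝒜 fun γ ↦ (𝒩 γ).comap e.toAddMonoidHom where
  smul_mem {α β r m} hr hm := by
    change e (op r • m) ∈ 𝒩 (β + α)
    rw [map_smul]
    exact GradedRightSMul.smul_mem hr hm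

/-! ### Flatness tested on homogeneous right ideals -/

section Flat

open DirectSum

variable {Γ : Type w} [AddCancelMonoid Γ] [DecidableEq Γ] {R : Type u} [Ring R]
  (𝒜 : Γ → AddSubgroup R) [GradedRing 𝒜]

/-- Every balanced biadditive map `K × F → ℚ/ℤ`, with `K` a homogeneous right ideal, is of the
form `(k, x) ↦ β (k · x)`. -/
def RightIdealFlat (F : Type*) [AddCommGroup F] [Module R F] : Prop :=
  ∀ K : Submodule Rᵐᵒᵖ R, K.IsHomogeneous 𝒜 → ∀ b : K →ₗ[Rᵐᵒᵖ] CharacterModule F,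
    ∃ β : CharacterModule F, ∀ (k : K) (x : F), b k x = β ((k : R) • x)

/-- The homomorphism `r ↦ m · r` of right modules. -/
def mulRightMap {M : Type*} [AddCommGroup M] [Module Rᵐᵒᵖ M] (m : M) : R →ₗ[Rᵐᵒᵖ] M where
  toFun r := op r • m
  map_add' r s := by rw [op_add, add_smul]
  map_smul' r s := by
    rw [RingHom.id_apply, ← mul_smul]
    rfl

theorem mulRightMap_apply {M : Type*} [AddCommGroup M] [Module Rᵐᵒᵖ M] (m : M) (r : R) :
    mulRightMap m r = op r • m := rfl

variable {𝒜} in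
theorem RightIdealFlat.exists_extension {F : Type*} [AddCommGroup F] [Module R F]
    (hF : RightIdealFlat 𝒜 F) {N : Type*} [AddCommGroup N] [Module Rᵐᵒᵖ N]
    (𝒩 : Γ → AddSubgroup N) [Decomposition 𝒩] [GradedRightSMul 𝒜 𝒩]
    (L : Submodule Rᵐᵒᵖ N) (hL : L.IsHomogeneous 𝒩) (b : L →ₗ[Rᵐᵒᵖ] CharacterModule F) :
    ∃ b' : N →ₗ[Rᵐᵒᵖ] CharacterModule F, ∀ l : L, b' l = b l := by
  refine exists_extension_of_isHomogeneous 𝒜 𝒩 (fun K hK φ ↦ ?_) (fun γ x hx ↦ ?_) L hL b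
  · obtain ⟨β, hβ⟩ := hF K hK φ
    refine ⟨mulRightMap β, fun k ↦ ?_⟩
    ext x
    exact (hβ k x).symm
  -- Cancellation in `Γ` makes the degree shift of `r ↦ x · r` injective.
  · exact ⟨fun α ↦ γ + α, mulRightMap x, add_right_injective γ,
      ⟨1, by rw [mulRightMap_apply, op_one, one_smul]⟩,
      fun α c hc ↦ GradedRightSMul.smul_mem hc hx⟩

variable {𝒜} in
theorem RightIdealFlat.isGrFlat {F : Type v} [AddCommGroup F] [Module R F]
    (hF : RightIdealFlat 𝒜 F) (ℱ : Γ → AddSubgroup F) : IsGrFlat 𝒜 ℱ := by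
  intro M N _ _ _ _ ℳ _ _ 𝒩 _ _ f hf hinj
  refine ⟨(tensorMap_injective_iff f).2 fun b ↦ ?_, fun γ t ↦ tensorMap_mem_tensorGrading ℱ f hf γ⟩
  let e := LinearEquiv.ofInjective f hinj
  have hL : (LinearMap.range f).IsHomogeneous 𝒩 := by
    rintro γ _ ⟨m, rfl⟩
    exact decompose_map_mem_range (s := id) ℳ 𝒩 f.toAddMonoidHom hf γ m
  obtain ⟨b', hb'⟩ := hF.exists_extension 𝒩 _ hL (b ∘ₗ e.symm.toLinearMap)
  refine ⟨b', fun m ↦ (hb' (e m)).trans ?_⟩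
  simp

instance gradedRightSMul_self : GradedRightSMul 𝒜 𝒜 where
  smul_mem hr hm := SetLike.mul_mem_graded hm hr

variable {𝒜} in
theorem IsGrFlat.rightIdealFlat {F : Type v} [AddCommGroup F] [Module R F]
    {ℱ : Γ → AddSubgroup F} (hF : IsGrFlat 𝒜 ℱ) : RightIdealFlat 𝒜 F := by
  intro K hK b
  -- The test modules must live in `Type (max u v)`.
  let eR : ULift.{v} R ≃ₗ[Rᵐᵒᵖ] R := ULift.moduleEquiv
  let eK : ULift.{v} K ≃ₗ[Rᵐᵒᵖ] K := ULift.moduleEquiv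
  let i : ULift.{v} K →ₗ[Rᵐᵒᵖ] R := K.subtype ∘ₗ eK.toLinearMap
  let := decompositionComap 𝒜 eR.toLinearMap.toAddMonoidHom eR.injective
    fun x γ ↦ ⟨eR.symm (decompose 𝒜 (eR x) γ), eR.apply_symm_apply _⟩
  let := decompositionComap 𝒜 i.toAddMonoidHom (K.injective_subtype.comp eK.injective)
    fun x γ ↦ ⟨eK.symm ⟨_, hK γ (eK x).2⟩, rfl⟩
  have := gradedRightSMul_comap 𝒜 𝒜 eR.toLinearMap
  have := gradedRightSMul_comap 𝒜 𝒜 i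
  have h := (hF (ULift.{v} K) (ULift.{v} R) (fun γ ↦ (𝒜 γ).comap i.toAddMonoidHom)
    (fun γ ↦ (𝒜 γ).comap eR.toLinearMap.toAddMonoidHom) (eR.symm.toLinearMap ∘ₗ i)
    (fun γ m hm ↦ hm)
    (eR.symm.injective.comp (K.injective_subtype.comp eK.injective))).1
  obtain ⟨b', hb'⟩ := (tensorMap_injective_iff _).1 h (b ∘ₗ eK.toLinearMap)
  -- A map on `R` is determined by its value `β` at `1`: it sends `k` to `β · k`.
  refine ⟨b' (eR.symm 1), fun k x ↦ ?_⟩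
  rw [← op_smul_character_apply, ← map_smul, ← map_smul]
  refine (DFunLike.congr_fun (hb' (eK.symm k)) x).symm.trans ?_
  congr 3
  change _ = eR.symm (1 * (k : R))
  rw [one_mul]
  rfl

theorem RightIdealFlat.of_equiv {F G : Type*} [AddCommGroup F] [Module R F] [AddCommGroup G]
    [Module R G] (e : F ≃ₗ[R] G) (hF : RightIdealFlat 𝒜 F) : RightIdealFlat 𝒜 G := by
  intro K hK b
  let b' : K →ₗ[Rᵐᵒᵖ] CharacterModule F :=
    flipLeft (flipRight b ∘ₗ e.toLinearMap)
  obtain ⟨β, hβ⟩ := hF K hK b'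
  refine ⟨β.comp e.symm.toLinearMap.toAddMonoidHom, fun k x ↦ ?_⟩
  have := hβ k (e.symm x)
  rw [← map_smul e.symm] at this
  rw [flipLeft_apply, LinearMap.comp_apply, flipRight_apply, LinearEquiv.coe_coe,
    e.apply_symm_apply] at this
  exact this

theorem rightIdealFlat_self : RightIdealFlat 𝒜 R := by
  intro K hK b
  -- `β` extends `k ↦ b k 1`, and balancing gives `b k r = b (k r) 1`.
  obtain ⟨β, hβ⟩ := exists_character_extension K.subtype.toAddMonoidHom K.injective_subtype
    (flipRight b 1)
  refine ⟨β, fun k r ↦ ?_⟩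
  have := hβ (op r • k)
  rw [flipRight_apply, map_smul b, op_smul_character_apply, smul_eq_mul, mul_one] at this
  exact this.symm

variable {𝒜} in
/-- If all homogeneous left ideals are flat, the characters of a homogeneous right ideal are
injective with respect to graded left modules. -/
theorem exists_left_extension
    (hI : ∀ I : Submodule R R, I.IsHomogeneous 𝒜 → RightIdealFlat 𝒜 I)
    {K : Submodule Rᵐᵒᵖ R} (hK : K.IsHomogeneous 𝒜) {F : Type*} [AddCommGroup F] [Module R F]
    (ℱ : Γ → AddSubgroup F) [Decomposition ℱ] [SetLike.GradedSMul 𝒜 ℱ]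
    (G : Submodule R F) (hG : G.IsHomogeneous ℱ) (b : G →ₗ[R] CharacterModule K) :
    ∃ b' : F →ₗ[R] CharacterModule K, ∀ x : G, b' x = b x := by
  refine exists_extension_of_isHomogeneous 𝒜 ℱ (fun I hIh φ ↦ ?_) (fun γ x hx ↦ ?_) G hG b
  · obtain ⟨β, hβ⟩ := hI I hIh K hK (flipLeft φ)
    obtain ⟨β', hβ'⟩ := exists_character_extension I.subtype.toAddMonoidHom I.injective_subtype β
    -- The extension is `r ↦ (k ↦ β' (k r))`.
    refine ⟨flipRight ((mulRightMap β' : R →ₗ[Rᵐᵒᵖ] CharacterModule R) ∘ₗ K.subtype), fun x ↦ ?_⟩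
    ext k
    exact (hβ' ((k : R) • x)).trans (hβ k x).symm
  · exact ⟨fun α ↦ α + γ, LinearMap.toSpanSingleton R F x, add_left_injective γ,
      ⟨1, LinearMap.toSpanSingleton_apply_one R F x⟩,
      fun α c hc ↦ SetLike.GradedSMul.smul_mem hc hx⟩

variable {𝒜} in
theorem RightIdealFlat.submodule
    (hI : ∀ I : Submodule R R, I.IsHomogeneous 𝒜 → RightIdealFlat 𝒜 I)
    {F : Type*} [AddCommGroup F] [Module R F] (hF : RightIdealFlat 𝒜 F)
    (ℱ : Γ → AddSubgroup F) [Decomposition ℱ] [SetLike.GradedSMul 𝒜 ℱ]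
    (G : Submodule R F) (hG : G.IsHomogeneous ℱ) : RightIdealFlat 𝒜 G := by
  intro K hK b
  obtain ⟨b', hb'⟩ := exists_left_extension hI hK ℱ G hG (flipRight b)
  obtain ⟨β, hβ⟩ := hF K hK (flipLeft b')
  refine ⟨β.comp G.subtype.toAddMonoidHom, fun k x ↦ ?_⟩
  exact (DFunLike.congr_fun (hb' x) k).symm.trans (hβ k x)

end Flat

end GrFlat

theorem corollary2p9 {Γ : Type w} [AddCancelMonoid Γ] [DecidableEq Γ] {R : Type u} [Ring R]
    (𝒜 : Γ → AddSubgroup R) [GradedRing 𝒜] :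
    (∀ I : Submodule R R, I.IsHomogeneous 𝒜 →
      GrFlat.IsGrFlat 𝒜 (GrFlat.inducedGrading 𝒜 I)) ↔
    ∀ (F : Type (max u v)) [AddCommGroup F] [Module R F] (ℱ : Γ → AddSubgroup F)
      [DirectSum.Decomposition ℱ] [SetLike.GradedSMul 𝒜 ℱ], GrFlat.IsGrFlat 𝒜 ℱ →
      ∀ N : Submodule R F, N.IsHomogeneous ℱ →
        GrFlat.IsGrFlat 𝒜 (GrFlat.inducedGrading ℱ N) := by
  open GrFlat in
  constructor
  · intro h F _ _ ℱ _ _ hF N hN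
    exact (hF.rightIdealFlat.submodule (fun I hI ↦ (h I hI).rightIdealFlat) ℱ N hN).isGrFlat _
  · intro h I hI
    -- `R` is lifted to the universe over which `F` ranges.
    let e : ULift.{v} R ≃ₗ[R] R := ULift.moduleEquiv
    let ℱ : Γ → AddSubgroup (ULift.{v} R) := fun γ ↦ (𝒜 γ).comap e.toLinearMap.toAddMonoidHom
    let : DirectSum.Decomposition ℱ := decompositionComap 𝒜 _ e.injective
      fun x γ ↦ ⟨e.symm (DirectSum.decompose 𝒜 (e x) γ), e.apply_symm_apply _⟩
    have : SetLike.GradedSMul 𝒜 ℱ := ⟨fun {α β r x} hr hx ↦ SetLike.mul_mem_graded (A := 𝒜) hr hx⟩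
    have hF : IsGrFlat 𝒜 ℱ := ((rightIdealFlat_self 𝒜).of_equiv 𝒜 e.symm).isGrFlat ℱ
    have hN : (I.comap e.toLinearMap).IsHomogeneous ℱ := fun γ x hx ↦ by
      have := decompose_map_apply ℱ 𝒜 Function.injective_id e.toLinearMap.toAddMonoidHom
        (fun _ _ h ↦ h) γ x
      exact this.subst (motive := (· ∈ I)) (hI γ hx)
    exact ((h _ ℱ hF _ hN).rightIdealFlat.of_equiv 𝒜
      (e.submoduleMap (I.comap e.toLinearMap) ≪≫ₗ
        LinearEquiv.ofEq _ _ (Submodule.map_comap_eq_of_surjective e.surjective I))).isGrFlat _
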